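/- For an integer $k\ge 1$, let $M_{2k+1}$ be the middle levels graph: its vertices are all $k$-element and all $(k+1)$-element subsets of $\{1,2,\ldots,2k+1\}$, with an edge between any two distinct sets one of which is a subset of the other. For a finite graph $G$ with $n$ vertices and a divisor $\ell$ of $n$, a $\mathcal{C}_\ell$-factor of $G$ is a collection of $n/\ell$ many pairwise vertex-disjoint cycles in $G$, each of length $\ell$ (so that these cycles together visit every vertex of $G$ exactly once). Theorem. For every integer $k\ge 1$, the middle levels graph $M_{2k+1}$ has a $\mathcal{C}_{4k+2}$-factor, and this factor consists of exactly $C_k=\frac{1}{k+1}\binom{2k}{k}$ cycles, where $C_k$ is the $k$-th Catalan number. -/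

import Mathlib

/-- The vertices of the middle levels graph: all `k`-element and all `(k+1)`-element subsets of a
ground set with `2k+1` elements. -/
abbrev MiddleLevelsVertex (k : ℕ) : Type :=
  {s : Finset (Fin (2 * k + 1)) // s.card = k ∨ s.card = k + 1}

/-- The middle levels graph `M_{2k+1}`: two distinct vertices are adjacent if and only if one of
them is a subset of the other. -/
def middleLevelsGraph (k : ℕ) : SimpleGraph (MiddleLevelsVertex k) where
  Adj s t := s ≠ t ∧ (s.1 ⊆ t.1 ∨ t.1 ⊆ s.1)
  symm := ⟨fun _ _ h => ⟨h.1.symm, h.2.symm⟩⟩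
  loopless := ⟨fun _ h => h.1 rfl⟩

/-- A subgraph that is a cycle of length `ℓ`: it consists of the vertices and the edges of a closed
walk of length `ℓ` that is a cycle. -/
def SimpleGraph.Subgraph.IsCycleOfLength {V : Type*} {G : SimpleGraph V} (H : G.Subgraph)
    (ℓ : ℕ) : Prop :=
  ∃ (v : V) (c : G.Walk v v), c.IsCycle ∧ c.length = ℓ ∧ c.toSubgraph = H

/-- `F` is a `C_ℓ`-factor of the finite graph `G` on `n` vertices: a collection of `n / ℓ` many
(an exact quotient) pairwise vertex-disjoint cycles of `G`, each of length `ℓ`. -/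
structure SimpleGraph.IsCycleFactor {V : Type*} [Fintype V] (G : SimpleGraph V) (ℓ : ℕ)
    (F : Finset G.Subgraph) : Prop where
  isCycle : ∀ H ∈ F, H.IsCycleOfLength ℓ
  disjoint : ∀ H ∈ F, ∀ H' ∈ F, H ≠ H' → Disjoint H.verts H'.verts
  card_mul : F.card * ℓ = Fintype.card V

namespace MiddleLevels

/-! Vertices are 0-1 words of length 2k+1. Each of the C_k binary trees with k nodes gives a Dyck
word U with complement D, and a path of single flips from U to D through words with k or k+1 ones.
For U = 1 u' 0 v, where u' is the reverse complement of a Dyck word u: flip that 0, run the path of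
u under reverse complement, flip the leading 1, run the path of v. Reverse complement turns a or a+1
ones (among 2a bits) into a or a-1, which makes room for the surplus 1 outside.

The path with 0 appended, followed by its complement with 1 appended, closes up to 4k+2 words.
First-passage decompositions show that every vertex occurs (`exists_mem_flipPath`). As there are
exactly C_k(4k+2) vertices, none occurs twice, so the cycles are simple and disjoint. -/

/-- Reversal combined with complementation of a `0-1` word. -/
def revCompl (w : List Bool) : List Bool := (w.map not).reverse

@[simp] lemma revCompl_revCompl (w : List Bool) : revCompl (revCompl w) = w := by
  simp [revCompl, Function.comp_def]

@[simp] lemma revCompl_nil : revCompl [] = [] := rfl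

@[simp] lemma revCompl_append (v w : List Bool) :
    revCompl (v ++ w) = revCompl w ++ revCompl v := by
  simp [revCompl]

@[simp] lemma revCompl_cons (x : Bool) (w : List Bool) :
    revCompl (x :: w) = revCompl w ++ [!x] := by
  simp [revCompl]

@[simp] lemma length_revCompl (w : List Bool) : (revCompl w).length = w.length := by
  simp [revCompl]

lemma map_not_map_not (w : List Bool) : (w.map not).map not = w := by
  simp [Function.comp_def]

lemma count_map_not (x : Bool) (w : List Bool) : (w.map not).count x = w.count (!x) := by
  induction w with
  | nil => rfl
  | cons y w ih => cases x <;> cases y <;> simp_all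

@[simp] lemma count_revCompl (x : Bool) (w : List Bool) : (revCompl w).count x = w.count (!x) := by
  rw [revCompl, List.count_reverse, count_map_not]

lemma map_not_revCompl (w : List Bool) : (revCompl w).map not = w.reverse := by
  simp [revCompl, Function.comp_def]

/-! ### Dyck words and first-passage decomposition -/

/-- A Dyck word (with `true` as up-step), encoded by a binary tree. -/
def upWord : BinaryTree Unit → List Bool
  | .nil => []
  | .node _ l r => true :: revCompl (upWord l) ++ false :: upWord r

/-- The complement of the Dyck word `upWord t`. -/
def downWord : BinaryTree Unit → List Bool
  | .nil => []
  | .node _ l r => false :: revCompl (downWord l) ++ true :: downWord r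

lemma map_not_upWord (t : BinaryTree Unit) : (upWord t).map not = downWord t := by
  induction t with
  | nil => rfl
  | node _ l r ihl ihr =>
    simp [upWord, downWord, ihr, ← ihl, revCompl]

lemma map_not_downWord (t : BinaryTree Unit) : (downWord t).map not = upWord t := by
  rw [← map_not_upWord, map_not_map_not]

lemma length_downWord (t : BinaryTree Unit) : (downWord t).length = 2 * t.numNodes := by
  induction t with
  | nil => rfl
  | node _ l r ihl ihr => simp [downWord, BinaryTree.numNodes, ihl, ihr]; ring

lemma count_downWord (t : BinaryTree Unit) (x : Bool) :
    (downWord t).count x = t.numNodes := by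
  induction t generalizing x with
  | nil => rfl
  | node _ l r ihl ihr => cases x <;> simp [downWord, BinaryTree.numNodes, ihl, ihr] <;> lia

lemma count_upWord (t : BinaryTree Unit) (x : Bool) : (upWord t).count x = t.numNodes := by
  rw [← map_not_downWord, count_map_not, count_downWord]

lemma exists_downWord_append (t t' : BinaryTree Unit) :
    ∃ t'', downWord t'' = downWord t ++ downWord t' := by
  induction t with
  | nil => exact ⟨t', rfl⟩
  | node a l r _ ihr =>
    obtain ⟨r', h⟩ := ihr
    exact ⟨.node a l r', by simp [downWord, h]⟩

/-- The encoding stores left subtrees mirrored, so a Dyck factor found in a given word must be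
mirrored back to yield a left subtree. -/
lemma exists_downWord_eq_revCompl (t : BinaryTree Unit) :
    ∃ t', downWord t' = revCompl (downWord t) := by
  induction t with
  | nil => exact ⟨.nil, rfl⟩
  | node a l r ihl ihr =>
    obtain ⟨l', hl⟩ := ihl
    obtain ⟨r', hr⟩ := ihr
    obtain ⟨t, ht⟩ := exists_downWord_append r' (.node a l' .nil)
    exact ⟨t, by simp [ht, hr, downWord, hl]⟩

lemma exists_upWord_eq_reverse_downWord (t : BinaryTree Unit) :
    ∃ t', upWord t' = (downWord t).reverse := by
  obtain ⟨t', h⟩ := exists_downWord_eq_revCompl t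
  exact ⟨t', by rw [← map_not_downWord, h, map_not_revCompl]⟩

/-- A word with at least as many ones as zeros is the complement of a Dyck word, or it starts with
such a word followed by a one. -/
lemma eq_downWord_or_exists_downWord_append (w : List Bool) (hw : w.count false ≤ w.count true) :
    (∃ t, w = downWord t) ∨ ∃ t q, w = downWord t ++ true :: q := by
  induction hn : w.length using Nat.strong_induction_on generalizing w with
  | _ n ih =>
  subst hn
  match w, hw with
  | [], _ => exact .inl ⟨.nil, rfl⟩
  | true :: q, _ => exact .inr ⟨.nil, q, rfl⟩
  | false :: w, hw =>
    simp only [List.count_cons_self, List.count_cons_of_ne (by decide : false ≠ true)] at hw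
    obtain ⟨t, rfl⟩ | ⟨t, q, rfl⟩ := ih w.length (by simp) w (by lia) rfl
    · simp [count_downWord] at hw
    obtain ⟨l, hl⟩ := exists_downWord_eq_revCompl t
    simp [count_downWord] at hw
    obtain ⟨t', rfl⟩ | ⟨t', q, rfl⟩ := ih q.length (by simp; lia) q (by lia) rfl
    · exact .inl ⟨.node () l t', by simp [downWord, hl]⟩
    · exact .inr ⟨.node () l t', q, by simp [downWord, hl]⟩

/-! ### Flip paths and their covering property -/

/-- A sequence of words that leads from `upWord t` to its complement by single bit flips. -/
def flipPath : BinaryTree Unit → List (List Bool)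
  | .nil => [[]]
  | .node a l r =>
    upWord (.node a l r) ::
      ((flipPath l).map (fun q ↦ true :: revCompl q ++ true :: upWord r) ++
        (flipPath r).map (fun q ↦ false :: revCompl (downWord l) ++ true :: q))

lemma length_flipPath (t : BinaryTree Unit) : (flipPath t).length = 2 * t.numNodes + 1 := by
  induction t with
  | nil => rfl
  | node a l r ihl ihr => simp [flipPath, BinaryTree.numNodes, ihl, ihr]; ring

lemma head?_flipPath (t : BinaryTree Unit) : (flipPath t).head? = some (upWord t) := by
  cases t <;> rfl

lemma getLast?_flipPath (t : BinaryTree Unit) : (flipPath t).getLast? = some (downWord t) := by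
  induction t with
  | nil => rfl
  | node a l r ihl ihr =>
    rw [flipPath, List.getLast?_cons, List.getLast?_append, List.getLast?_map, ihr]
    simp [downWord]

/-- The words of `flipPath t` have length `2 * t.numNodes` and contain `t.numNodes` or
`t.numNodes + 1` ones. -/
lemma count_of_mem_flipPath (t : BinaryTree Unit) {w : List Bool} (hw : w ∈ flipPath t) :
    w.count true + w.count false = 2 * t.numNodes ∧
      (w.count true = t.numNodes ∨ w.count true = t.numNodes + 1) := by
  induction t generalizing w with
  | nil => simp_all [flipPath]
  | node a l r ihl ihr =>
    simp only [flipPath, List.mem_cons, List.mem_append, List.mem_map] at hw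
    obtain rfl | ⟨q, hq, rfl⟩ | ⟨q, hq, rfl⟩ := hw
    · simp only [count_upWord]; lia
    · have := ihl hq
      simp [count_upWord, BinaryTree.numNodes]
      lia
    · have := ihr hq
      simp [count_downWord, BinaryTree.numNodes]
      lia

/-- Every word of even length `2 * n` with `n` or `n + 1` ones lies on some flip path. -/
lemma exists_mem_flipPath (w : List Bool)
    (hw : w.count true = w.count false ∨ w.count true = w.count false + 2) :
    ∃ t, w ∈ flipPath t := by
  induction hn : w.length using Nat.strong_induction_on generalizing w with
  | _ n ih =>
  subst hn
  match w, hw with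
  | [], _ => exact ⟨.nil, by simp [flipPath]⟩
  | false :: w, hw =>
    simp at hw
    -- A leading 0 belongs to the last segment of a path; the 1 found here is the first return to
    -- height 0.
    obtain ⟨t, rfl⟩ | ⟨t, q, rfl⟩ := eq_downWord_or_exists_downWord_append w (by lia)
    · simp only [count_downWord] at hw; lia
    simp [count_downWord] at hw
    obtain ⟨r, hr⟩ := ih q.length (by simp; lia) q (by lia) rfl
    obtain ⟨l, hl⟩ := exists_downWord_eq_revCompl t
    exact ⟨.node () l r, by simp [flipPath, hl, hr]⟩
  | true :: w, hw =>
    -- Read from the right: either the word is a Dyck word, the start of a path, or it is `1 p 1 U`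
    -- with `U` a Dyck word, in the middle segment.
    obtain ⟨t, ht⟩ | ⟨t, q, hq⟩ :=
      eq_downWord_or_exists_downWord_append (true :: w).reverse
        (by simp only [List.count_reverse]; lia)
    · obtain ⟨t', ht'⟩ := exists_upWord_eq_reverse_downWord t
      rw [← ht, List.reverse_reverse] at ht'
      exact ⟨t', ht' ▸ List.mem_of_mem_head? (head?_flipPath t')⟩
    · obtain ⟨r, hr⟩ := exists_upWord_eq_reverse_downWord t
      have hq' : true :: w = q.reverse ++ true :: upWord r := by
        rw [hr, ← List.reverse_reverse (true :: w), hq]; simp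
      rw [hq'] at hw ⊢
      obtain h | ⟨p, hp⟩ : q.reverse = [] ∨ ∃ p, q.reverse = true :: p := by
        cases h : q.reverse with
        | nil => exact .inl rfl
        | cons x p => rw [h] at hq'; simp at hq'; exact .inr ⟨p, by rw [← hq'.1]⟩
      -- The word `1 U` would have odd length.
      · simp [h, count_upWord] at hw
      · rw [hp] at hw hq' ⊢
        simp [count_upWord] at hw
        obtain ⟨l, hl⟩ := ih (revCompl p).length
          (by rw [hq']; simp) (revCompl p) (by simp; lia) rfl
        exact ⟨.node () l r, by
          simp only [flipPath, List.mem_cons, List.mem_append, List.mem_map]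
          exact .inr (.inl ⟨_, hl, by simp⟩)⟩

/-! ### Single flips and closed flip sequences -/

/-- Two words differ in exactly one position. -/
def SingleFlip (v w : List Bool) : Prop :=
  ∃ p x q, v = p ++ x :: q ∧ w = p ++ (!x) :: q

lemma SingleFlip.append_left {v w : List Bool} (h : SingleFlip v w) (u : List Bool) :
    SingleFlip (u ++ v) (u ++ w) := by
  obtain ⟨p, x, q, rfl, rfl⟩ := h
  exact ⟨u ++ p, x, q, by simp, by simp⟩

lemma SingleFlip.append_right {v w : List Bool} (h : SingleFlip v w) (u : List Bool) :
    SingleFlip (v ++ u) (w ++ u) := by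
  obtain ⟨p, x, q, rfl, rfl⟩ := h
  exact ⟨p, x, q ++ u, by simp, by simp⟩

lemma SingleFlip.map_not {v w : List Bool} (h : SingleFlip v w) :
    SingleFlip (v.map not) (w.map not) := by
  obtain ⟨p, x, q, rfl, rfl⟩ := h
  exact ⟨p.map not, !x, q.map not, by simp, by simp⟩

lemma SingleFlip.revCompl {v w : List Bool} (h : SingleFlip v w) :
    SingleFlip (revCompl v) (revCompl w) := by
  obtain ⟨p, x, q, rfl, rfl⟩ := h
  exact ⟨MiddleLevels.revCompl q, !x, MiddleLevels.revCompl p, by simp, by simp⟩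

lemma isChain_flipPath (t : BinaryTree Unit) : (flipPath t).IsChain SingleFlip := by
  induction t with
  | nil => simp [flipPath]
  | node a l r ihl ihr =>
    rw [flipPath, List.isChain_cons, List.isChain_append]
    refine ⟨?_, ?_, ?_, ?_⟩
    · rw [List.head?_append, List.head?_map, head?_flipPath]
      rintro _ ⟨⟩
      exact ⟨true :: MiddleLevels.revCompl (upWord l), false, upWord r, by simp [upWord], by simp⟩
    · rw [List.isChain_map]
      exact ihl.imp fun v w h ↦ (h.revCompl.append_left [true]).append_right _
    · rw [List.isChain_map]
      exact ihr.imp fun v w h ↦ by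
        simpa using h.append_left (false :: MiddleLevels.revCompl (downWord l) ++ [true])
    · rw [List.head?_map, head?_flipPath, List.getLast?_map, getLast?_flipPath]
      rintro _ ⟨⟩ _ ⟨⟩
      exact ⟨[], true, MiddleLevels.revCompl (downWord l) ++ true :: upWord r, by simp, by simp⟩

/-- A closed sequence of words, in which cyclically consecutive words differ by a single flip: the
flip path of `t` followed by its complement, distinguished by an additional last bit. -/
def flipCycle (t : BinaryTree Unit) : List (List Bool) :=
  (flipPath t).map (· ++ [false]) ++ (flipPath t).map (fun w ↦ w.map not ++ [true])

lemma length_flipCycle (t : BinaryTree Unit) : (flipCycle t).length = 4 * t.numNodes + 2 := by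
  simp [flipCycle, length_flipPath]; ring

lemma isChain_flipCycle (t : BinaryTree Unit) : (flipCycle t).IsChain SingleFlip := by
  rw [flipCycle, List.isChain_append, List.isChain_map, List.isChain_map]
  refine ⟨(isChain_flipPath t).imp fun v w h ↦ h.append_right _,
    (isChain_flipPath t).imp fun v w h ↦ h.map_not.append_right _, ?_⟩
  rw [List.head?_map, head?_flipPath, List.getLast?_map, getLast?_flipPath]
  rintro _ ⟨⟩ _ ⟨⟩
  -- The complemented path starts at `downWord t`, so only the appended bit changes.
  exact ⟨downWord t, false, [], rfl, by simp [map_not_upWord]⟩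

lemma head?_flipCycle (t : BinaryTree Unit) :
    (flipCycle t).head? = some (upWord t ++ [false]) := by
  rw [flipCycle, List.head?_append, List.head?_map, head?_flipPath]; rfl

lemma getLast?_flipCycle (t : BinaryTree Unit) :
    (flipCycle t).getLast? = some (upWord t ++ [true]) := by
  rw [flipCycle, List.getLast?_append, List.getLast?_map, getLast?_flipPath]
  simp [map_not_downWord]

lemma count_of_mem_flipCycle (t : BinaryTree Unit) {w : List Bool} (hw : w ∈ flipCycle t) :
    w.length = 2 * t.numNodes + 1 ∧
      (w.count true = t.numNodes ∨ w.count true = t.numNodes + 1) := by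
  simp only [flipCycle, List.mem_append, List.mem_map] at hw
  obtain ⟨q, hq, rfl⟩ | ⟨q, hq, rfl⟩ := hw <;>
  · have := count_of_mem_flipPath t hq
    have := List.count_true_add_count_false q
    simp [count_map_not]
    lia

lemma exists_mem_flipCycle {n : ℕ} (w : List Bool) (hl : w.length = 2 * n + 1)
    (hw : w.count true = n ∨ w.count true = n + 1) : ∃ t, t.numNodes = n ∧ w ∈ flipCycle t := by
  suffices ∃ t, w ∈ flipCycle t by
    obtain ⟨t, ht⟩ := this
    have := (count_of_mem_flipCycle t ht).1
    exact ⟨t, by lia, ht⟩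
  obtain rfl | ⟨v, x, rfl⟩ := List.eq_nil_or_concat' w
  · simp at hl
  have := List.count_true_add_count_false v
  cases x with
  | false =>
    simp at hl hw
    obtain ⟨t, ht⟩ := exists_mem_flipPath v (by lia)
    exact ⟨t, by simp [flipCycle, ht]⟩
  | true =>
    simp at hl hw
    obtain ⟨t, ht⟩ := exists_mem_flipPath (v.map not) (by simp [count_map_not]; lia)
    exact ⟨t, by
      simp only [flipCycle, List.mem_append, List.mem_map]
      exact .inr ⟨_, ht, by rw [map_not_map_not]⟩⟩

/-! ### From words to vertices -/

/-- The subset of `Fin n` with the given indicator word. -/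
def support (n : ℕ) (w : List Bool) : Finset (Fin n) := {i | w.getD i false = true}

lemma card_support {n : ℕ} {w : List Bool} (hw : w.length = n) :
    (support n w).card = w.count true := by
  subst hw
  induction w with
  | nil => rfl
  | cons x w ih =>
    have h := Fin.card_filter_univ_succ (n := w.length)
      (fun i ↦ (x :: w).getD i false = true)
    rw [support] at ih ⊢
    simp only [List.length_cons]
    rw [h]
    cases x <;> simp_all

lemma support_ofFn {n : ℕ} (s : Finset (Fin n)) :
    support n (List.ofFn fun i ↦ decide (i ∈ s)) = s := by
  ext i
  simp [support]

lemma support_subset_support (n : ℕ) (p q : List Bool) :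
    support n (p ++ false :: q) ⊆ support n (p ++ true :: q) := by
  intro i
  simp only [support, Finset.mem_filter, Finset.mem_univ, true_and, List.getD_eq_getElem?_getD,
    List.getElem?_append, List.getElem?_cons]
  split_ifs <;> simp

lemma SingleFlip.support {n : ℕ} {v w : List Bool} (h : SingleFlip v w) (hv : v.length = n) :
    support n v ≠ support n w ∧ (support n v ⊆ support n w ∨ support n w ⊆ support n v) := by
  obtain ⟨p, x, q, rfl, rfl⟩ := h
  constructor
  · intro h
    have h := congrArg Finset.card h
    rw [card_support hv, card_support (by simpa using hv)] at h
    cases x <;> simp at h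
  · cases x
    · exact .inl (support_subset_support n p q)
    · exact .inr (support_subset_support n p q)

lemma card_middleLevelsVertex (k : ℕ) :
    Fintype.card (MiddleLevelsVertex k) = catalan k * (4 * k + 2) := by
  have h : Fintype.card (MiddleLevelsVertex k) =
      (2 * k + 1).choose k + (2 * k + 1).choose (k + 1) := by
    rw [Fintype.card_subtype_or_disjoint]
    · simp [Fintype.card_finset_len]
    · rw [Pi.disjoint_iff]
      intro s
      simp only [Prop.disjoint_iff]
      lia
  have h₁ : (2 * k + 1).choose k = (2 * k + 1).choose (k + 1) :=
    Nat.choose_symm_half k |>.symm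
  have h₂ := Nat.add_one_mul_choose_eq (2 * k) k
  have h₃ := succ_mul_catalan_eq_centralBinom k
  rw [Nat.centralBinom] at h₃
  rw [h, h₁]
  -- The factor k+1 brings in the division-free Catalan identity.
  refine Nat.eq_of_mul_eq_mul_right k.succ_pos ?_
  rw [← h₃] at h₂
  simp only [Nat.succ_eq_add_one]
  linear_combination 2 * h₂.symm

/-- The vertices of the middle levels graph on the closed sequence `flipCycle t`. -/
def cycleVertex (k n : ℕ) (hn : n = 4 * k + 2) (t : BinaryTree.treesOfNumNodesEq k) (j : Fin n) :
    MiddleLevelsVertex k :=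
  have ht : t.1.numNodes = k := BinaryTree.mem_treesOfNumNodesEq.mp t.2
  have hj : j < (flipCycle t.1).length := by rw [length_flipCycle, ht, ← hn]; exact j.2
  ⟨support (2 * k + 1) (flipCycle t.1)[j], by
    have h := count_of_mem_flipCycle t.1 (List.getElem_mem hj)
    rw [ht] at h
    rw [Fin.getElem_fin, card_support h.1]
    exact h.2⟩

lemma cycleVertex_adj (k n : ℕ) (hn : n + 1 = 4 * k + 2) (t : BinaryTree.treesOfNumNodesEq k)
    (j : Fin (n + 1)) :
    (middleLevelsGraph k).Adj (cycleVertex k _ hn t j) (cycleVertex k _ hn t (j + 1)) := by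
  have ht : t.1.numNodes = k := BinaryTree.mem_treesOfNumNodesEq.mp t.2
  have hl := length_flipCycle t.1
  rw [ht] at hl
  suffices h : SingleFlip ((flipCycle t.1)[(j : ℕ)]'(by lia))
      ((flipCycle t.1)[((j + 1 : Fin (n + 1)) : ℕ)]'(by have := (j + 1).isLt; lia)) by
    have hs := h.support
      ((count_of_mem_flipCycle t.1 (List.getElem_mem _)).1.trans (by rw [ht]))
    exact ⟨fun h' ↦ hs.1 (congrArg Subtype.val h'), hs.2⟩
  -- At the last index `j + 1` wraps to 0: the closing edge flips the appended bit of `upWord`.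
  obtain rfl | hj := eq_or_ne j (Fin.last n)
  · have h₀ := head?_flipCycle t.1
    have h₁ := getLast?_flipCycle t.1
    rw [List.head?_eq_getElem?, List.getElem?_eq_some_iff] at h₀
    rw [List.getLast?_eq_getElem?, List.getElem?_eq_some_iff] at h₁
    obtain ⟨_, h₀⟩ := h₀
    obtain ⟨_, h₁⟩ := h₁
    have hlast : (flipCycle t.1).length - 1 = n := by lia
    simp only [hlast] at h₁
    simp only [Fin.last_add_one, Fin.val_zero, Fin.val_last, h₀, h₁]
    exact ⟨upWord t.1, true, [], rfl, rfl⟩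
  · have hj' : ((j + 1 : Fin (n + 1)) : ℕ) = j + 1 :=
      Fin.val_add_one_of_lt (Fin.lt_last_iff_ne_last.mpr hj)
    simp only [hj']
    exact (isChain_flipCycle t.1).getElem _ _

lemma cycleVertex_bijective (k n : ℕ) (hn : n = 4 * k + 2) :
    Function.Bijective fun p : BinaryTree.treesOfNumNodesEq k × Fin n ↦
      cycleVertex k n hn p.1 p.2 := by
  -- Counting replaces any direct proof of injectivity.
  rw [Fintype.bijective_iff_surjective_and_card]
  constructor
  · rintro ⟨s, hs⟩
    set w := List.ofFn fun i ↦ decide (i ∈ s) with hw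
    have hws : support (2 * k + 1) w = s := support_ofFn s
    have hl : w.length = 2 * k + 1 := by simp [hw]
    have hs' := hs
    rw [← hws, card_support hl] at hs'
    obtain ⟨t, ht, hmem⟩ := exists_mem_flipCycle w hl hs'
    obtain ⟨j, hj, hjw⟩ := List.getElem_of_mem hmem
    rw [length_flipCycle, ht, ← hn] at hj
    refine ⟨(⟨t, BinaryTree.mem_treesOfNumNodesEq.mpr ht⟩, ⟨j, hj⟩), Subtype.ext ?_⟩
    simp only [cycleVertex, Fin.getElem_fin, hjw, hws]
  · rw [Fintype.card_prod, Fintype.card_coe, BinaryTree.treesOfNumNodesEq_card_eq_catalan,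
      Fintype.card_fin, card_middleLevelsVertex, hn]

end MiddleLevels

namespace SimpleGraph

/-! ### Assembling the factor -/

/-- Cycles of length `n + 3`, parametrized by maps that jointly form a bijection onto the vertices,
constitute a cycle factor. -/
lemma exists_isCycleFactor_of_bijective {V ι : Type*} [Fintype V] [Fintype ι]
    (G : SimpleGraph V) (n : ℕ) (f : ι → Fin (n + 3) → V)
    (hadj : ∀ i j, G.Adj (f i j) (f i (j + 1)))
    (hf : Function.Bijective fun p : ι × Fin (n + 3) ↦ f p.1 p.2) :
    ∃ F : Finset G.Subgraph, G.IsCycleFactor (n + 3) F ∧ F.card = Fintype.card ι := by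
  classical
  let φ (i : ι) : cycleGraph (n + 3) →g G :=
    { toFun := f i
      map_rel' := by
        intro a b hab
        rw [cycleGraph_adj] at hab
        obtain h | h := hab
        · rw [sub_eq_iff_eq_add'.mp h, add_comm]
          exact (add_comm b 1 ▸ hadj i b).symm
        · rw [sub_eq_iff_eq_add'.mp h]
          exact add_comm a 1 ▸ hadj i a }
  let c (i : ι) : G.Subgraph := ((cycleGraph.cycle n).map (φ i)).toSubgraph
  have hverts {i : ι} {v : V} (hv : v ∈ (c i).verts) : ∃ j, f i j = v := by
    simp only [c, Walk.mem_verts_toSubgraph, Walk.support_map, List.mem_map] at hv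
    obtain ⟨j, -, rfl⟩ := hv
    exact ⟨j, rfl⟩
  have hdisj {i i' : ι} {v : V} (hv : v ∈ (c i).verts) (hv' : v ∈ (c i').verts) : i = i' := by
    obtain ⟨j, hj⟩ := hverts hv
    obtain ⟨j', hj'⟩ := hverts hv'
    exact congrArg Prod.fst (@hf.1 (i, j) (i', j') (hj.trans hj'.symm))
  have hc : Function.Injective c := fun i i' h ↦
    hdisj (Walk.start_mem_verts_toSubgraph _)
      (show φ i 0 ∈ (c i').verts from h ▸ Walk.start_mem_verts_toSubgraph _)
  have hcard : (Finset.univ.image c).card = Fintype.card ι :=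
    Finset.card_image_of_injective _ hc
  refine ⟨Finset.univ.image c, ⟨?_, ?_, ?_⟩, hcard⟩
  · intro H hH
    obtain ⟨i, -, rfl⟩ := Finset.mem_image.mp hH
    refine ⟨_, (cycleGraph.cycle n).map (φ i), ?_, by simp, rfl⟩
    refine (Walk.isCycle_map_iff_of_injective fun j j' h ↦ ?_).mpr cycleGraph.isCycle_cycle
    exact congrArg Prod.snd (@hf.1 (i, j) (i, j') h)
  · intro H hH H' hH' hne
    obtain ⟨i, -, rfl⟩ := Finset.mem_image.mp hH
    obtain ⟨i', -, rfl⟩ := Finset.mem_image.mp hH'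
    exact Set.disjoint_left.mpr fun v hv hv' ↦ hne (congrArg c (hdisj hv hv'))
  · rw [hcard, ← Fintype.card_of_bijective hf, Fintype.card_prod, Fintype.card_fin]

end SimpleGraph

theorem theorem5 (k : ℕ) (hk : 1 ≤ k) :
    ∃ F : Finset (middleLevelsGraph k).Subgraph,
      (middleLevelsGraph k).IsCycleFactor (4 * k + 2) F ∧ F.card = catalan k := by
  -- With k ≥ 1 the length 4k+2 has the form n+3 needed for a genuine cycle.
  obtain ⟨m, rfl⟩ : ∃ m, k = m + 1 := ⟨k - 1, by lia⟩
  have hn : 4 * m + 3 + 3 = 4 * (m + 1) + 2 := by ring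
  obtain ⟨F, hF, hcard⟩ := SimpleGraph.exists_isCycleFactor_of_bijective
    (middleLevelsGraph (m + 1)) (4 * m + 3) (MiddleLevels.cycleVertex (m + 1) _ hn)
    (MiddleLevels.cycleVertex_adj (m + 1) _ hn) (MiddleLevels.cycleVertex_bijective (m + 1) _ hn)
  exact ⟨F, hn ▸ hF, by
    rw [hcard, Fintype.card_coe, BinaryTree.treesOfNumNodesEq_card_eq_catalan]⟩
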